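/- For $s_1,\dots,s_r\in\mathbb N=\{1,2,3,\dots\}$, each of which may carry a bar, put $$\zeta_n(s_1,\dots,s_r)=\sum_{n\ge k_1>k_2>\cdots>k_r\ge 1}\ \prod_{i=1}^r\frac{\varepsilon_i^{k_i}}{k_i^{s_i}},\qquad \zeta(s_1,\dots,s_r)=\lim_{n\to\infty}\zeta_n(s_1,\dots,s_r),$$ where $\varepsilon_i=-1$ if $s_i$ carries a bar and $\varepsilon_i=1$ otherwise (a barred argument $\bar s_i$ has the exponent $s_i$). Write $\{1\}_j$ for the sequence of $j$ ones, and $\mathrm{Li}_p(x)=\sum_{n\ge1}x^n/n^p$ for the polylogarithm. Theorem. For all integers $m,k\ge 1$, the limits defining the alternating multiple zeta values $$\zeta(\bar 1,\{1\}_{m-1},\bar 1)\quad\text{and}\quad \zeta(\bar 1,\{1\}_{m-1},2,\{1\}_{k-1})$$ exist, and both values are expressible in terms of zeta values, polylogarithms at $1/2$ and $\ln 2$: each of them is a linear combination with rational coefficients of (possibly empty) products of the numbers $\zeta(n)$ ($n\ge 2$ an integer), $\mathrm{Li}_p(1/2)$ ($p\ge 1$ an integer) and $\ln 2$, i.e.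 it lies in the $\mathbb Q$-subalgebra of $\mathbb R$ generated by these numbers. -/

import Mathlib

open Filter Topology

/-- One argument of an alternating multiple zeta value: a positive integer `exponent`,
written with a bar on top if `barred` is `true`. -/
structure MZVArg where
  exponent : ℕ
  barred : Bool

namespace MZVArg

/-- The unbarred argument `s`. -/
def plain (s : ℕ) : MZVArg := ⟨s, false⟩

/-- The barred argument `s̄`. -/
def bar (s : ℕ) : MZVArg := ⟨s, true⟩

/-- The factor contributed by the argument at the summation index `j`:
`1 / j ^ s` for `s`, and `(-1) ^ j / j ^ s` for `s̄`. -/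
noncomputable def factor (a : MZVArg) (j : ℕ) : ℝ :=
  (if a.barred then (-1 : ℝ) ^ j else 1) / (j : ℝ) ^ a.exponent

end MZVArg

/-- The (alternating) multiple harmonic number `ζ_n(s₁, …, s_r)`, that is, the sum over
`n ≥ k₁ > k₂ > ⋯ > k_r ≥ 1` of the product of the factors of the `s_i` at `k_i`.
The largest index `k₁` is `j + 1` with `j < n`, and the remaining indices
run over `j ≥ k₂ > ⋯ > k_r ≥ 1`. -/
noncomputable def multipleHarmonic : List MZVArg → ℕ → ℝ
  | [], _ => 1
  | a :: l, n => ∑ j ∈ Finset.range n, a.factor (j + 1) * multipleHarmonic l j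

/-- The (alternating) multiple zeta value `ζ(s₁, …, s_r)` exists and equals `z`: it is the
limit of the multiple harmonic numbers `ζ_n(s₁, …, s_r)` as `n → ∞`. -/
def HasMultipleZetaValue (l : List MZVArg) (z : ℝ) : Prop :=
  Tendsto (multipleHarmonic l) atTop (𝓝 z)

/-- The polylogarithm `Li_p(x) = ∑_{n ≥ 1} x ^ n / n ^ p` (used for `|x| < 1`). -/
noncomputable def polylogarithm (p : ℕ) (x : ℝ) : ℝ :=
  ∑' n : ℕ, x ^ (n + 1) / ((n : ℝ) + 1) ^ p

/-- The real numbers which are rational linear combinations of products of zeta values `ζ(n)`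
(`n ≥ 2` an integer), polylogarithms `Li_p(1/2)` (`p ≥ 1` an integer) and `ln 2`. -/
noncomputable def zetaPolylogAlgebra : Subalgebra ℚ ℝ :=
  Algebra.adjoin ℚ
    ({x : ℝ | ∃ n : ℕ, 2 ≤ n ∧ (x : ℂ) = riemannZeta n} ∪
      {x : ℝ | ∃ p : ℕ, 1 ≤ p ∧ x = polylogarithm p (1 / 2)} ∪
      {Real.log 2})

/-! ### Power series and a uniqueness principle -/

/-! Write F_l(y) for the power series `multiplePolylog l y`. A leading bar amounts to y ↦ -y, so by
Abel's theorem a value with first argument 1̄ is the limit at y → -1⁺ of F_{1,l}, once its defining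
series is known to converge. Convergence is Dirichlet's test, fed by the crude bound O(√n) on
multiple harmonic numbers.

On (-1, 0) one has F_{1,l}' = F_l/(1-y) and F_{2,l}' = F_{1,l}/y. With L = -log(1-y), dL = dy/(1-y),
so each leading 1 is one integration in L. Both families are then computed by matching derivatives
and the limit 0 at y = 0.

For ({1}_m, 1̄), F is (-1)^m Li_{m+1}((1-y)/2) plus a polynomial in L with coefficients built from
Li_p(1/2) (`multiplePolylog_onesBar`). For ({1}_m, 2, {1}_k), an integration by parts removes the
leading ones at the price of more trailing ones (`multiplePolylog_onesTwoOnes_succ`), and the case m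
= 0 is integrated explicitly after u = 1/(1-y) (`multiplePolylog_onesTwoOnes_zero`). At y = -1 one
has L = -log 2, u = 1/2 and (1-y)/2 = 1, so only log 2, Li_p(1/2) and Li_p(1) = ζ(p) with p ≥ 2
occur. -/

lemma summable_linear_mul_pow (C : ℝ) {r : ℝ} (hr : |r| < 1) :
    Summable fun n : ℕ => C * ((n : ℝ) + 1) * r ^ n := by
  have h1 := summable_pow_mul_geometric_of_norm_lt_one 1 (r := r) (by simpa using hr)
  have h2 := summable_geometric_of_norm_lt_one (x := r) (by simpa using hr)
  refine ((h1.add h2).mul_left C).congr fun n => ?_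
  ring

lemma summable_mul_pow_of_abs_le_linear {c : ℕ → ℝ} {C : ℝ} (hc : ∀ n, |c n| ≤ C * (n + 1))
    {x : ℝ} (hx : |x| < 1) : Summable fun n => c n * x ^ n := by
  refine Summable.of_norm_bounded (summable_linear_mul_pow C (r := |x|) (by simpa using hx))
    fun n => ?_
  rw [Real.norm_eq_abs, abs_mul, abs_pow]
  exact mul_le_mul_of_nonneg_right (hc n) (by positivity)

lemma hasDerivAt_tsum_div_mul_pow_succ {c : ℕ → ℝ} {C : ℝ} (hc : ∀ n, |c n| ≤ C * (n + 1))
    {x : ℝ} (hx : |x| < 1) :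
    HasDerivAt (fun y : ℝ => ∑' n : ℕ, c n / ((n : ℝ) + 1) * y ^ (n + 1))
      (∑' n : ℕ, c n * x ^ n) x := by
  obtain ⟨r, hxr, hr⟩ := exists_between hx
  have hr0 : 0 < r := (abs_nonneg x).trans_lt hxr
  refine hasDerivAt_tsum_of_isPreconnected (t := Metric.ball 0 r) (y₀ := 0)
    (g := fun n y => c n / ((n : ℝ) + 1) * y ^ (n + 1)) (g' := fun n y => c n * y ^ n)
    (summable_linear_mul_pow C (r := r) (by rwa [abs_of_pos hr0])) Metric.isOpen_ball
    (convex_ball 0 r).isPreconnected (fun n y _ => ?_) (fun n y hy => ?_) (by simpa using hr0)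
    (by simp) (by simpa using hxr)
  · have h := (hasDerivAt_pow (n + 1) y).const_mul (c n / ((n : ℝ) + 1))
    refine h.congr_deriv ?_
    have : (n : ℝ) + 1 ≠ 0 := by positivity
    push_cast
    field_simp
  · have hy' : |y| < r := by simpa using hy
    rw [Real.norm_eq_abs, abs_mul, abs_pow]
    have h0 := hc n
    have : |y| ^ n ≤ r ^ n := pow_le_pow_left₀ (abs_nonneg y) hy'.le n
    exact mul_le_mul h0 this (by positivity) ((abs_nonneg _).trans h0)

/-- Two functions on `(-1, 0)` with the same derivative and the same limit at `0` agree. -/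
lemma eqOn_of_hasDerivAt_of_tendsto {f g d : ℝ → ℝ} {a : ℝ}
    (hf : ∀ y ∈ Set.Ioo (-1 : ℝ) 0, HasDerivAt f (d y) y)
    (hg : ∀ y ∈ Set.Ioo (-1 : ℝ) 0, HasDerivAt g (d y) y)
    (hfa : Tendsto f (𝓝[<] 0) (𝓝 a)) (hga : Tendsto g (𝓝[<] 0) (𝓝 a)) :
    ∀ y ∈ Set.Ioo (-1 : ℝ) 0, f y = g y := by
  intro y hy
  have hd : ∀ z ∈ Set.Ioo (-1 : ℝ) 0, HasDerivAt (fun z => f z - g z) 0 z := fun z hz =>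
    ((hf z hz).sub (hg z hz)).congr_deriv (sub_self _)
  have hconst : ∀ z ∈ Set.Ioo (-1 : ℝ) 0, f z - g z = f y - g y := fun z hz =>
    isOpen_Ioo.is_const_of_deriv_eq_zero (f := fun z => f z - g z) isPreconnected_Ioo
      (fun w hw => (hd w hw).differentiableAt.differentiableWithinAt)
      (fun w hw => (hd w hw).deriv) hz hy
  have hmem : Set.Ioo (-1 : ℝ) 0 ∈ 𝓝[<] (0 : ℝ) := Ioo_mem_nhdsLT (by norm_num)
  have h1 : Tendsto (fun z => f z - g z) (𝓝[<] 0) (𝓝 (f y - g y)) :=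
    tendsto_const_nhds.congr' (by filter_upwards [hmem] with z hz using (hconst z hz).symm)
  have h2 := tendsto_nhds_unique h1 (hfa.sub hga)
  linarith

/-! ### Growth of multiple harmonic numbers and convergence of alternating series -/

lemma MZVArg.abs_factor_succ_le {a : MZVArg} (ha : 1 ≤ a.exponent) (j : ℕ) :
    |a.factor (j + 1)| ≤ 1 / ((j : ℝ) + 1) := by
  have h1 : (1 : ℝ) ≤ (j : ℝ) + 1 := by linarith [j.cast_nonneg (α := ℝ)]
  have h2 : (j : ℝ) + 1 ≤ ((j : ℝ) + 1) ^ a.exponent := le_self_pow₀ h1 (by omega)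
  have h3 : |(if a.barred then (-1 : ℝ) ^ (j + 1) else 1)| = 1 := by
    split_ifs <;> simp
  rw [MZVArg.factor, abs_div, h3]
  push_cast
  rw [abs_of_pos (by positivity)]
  exact one_div_le_one_div_of_le (by positivity) h2

lemma sum_range_inv_sqrt_le (n : ℕ) :
    ∑ j ∈ Finset.range n, 1 / √((j : ℝ) + 1) ≤ 2 * √(n : ℝ) := by
  induction n with
  | zero => simp
  | succ m ih =>
    rw [Finset.sum_range_succ]
    push_cast
    set s := √(m : ℝ)
    set t := √((m : ℝ) + 1)
    have hs : s ^ 2 = m := Real.sq_sqrt (by positivity)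
    have ht : t ^ 2 = m + 1 := Real.sq_sqrt (by positivity)
    have ht0 : 0 < t := by positivity
    -- Since t² - s² = 1, the claim multiplied by t reads 1 ≤ (t - s)² + 1.
    have : 1 / t ≤ 2 * t - 2 * s := by
      rw [div_le_iff₀ ht0]
      nlinarith [sq_nonneg (t - s)]
    linarith

lemma one_div_mul_mul_sqrt {x : ℝ} (hx : 0 < x) (K : ℝ) : 1 / x * (K * √x) = K / √x := by
  have h0 : 0 < √x := Real.sqrt_pos.2 hx
  rw [one_div_mul_eq_div, div_eq_div_iff hx.ne' h0.ne', mul_assoc, Real.mul_self_sqrt hx.le]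

/-- The true growth is at most a power of log n; √n is preferred because it reproduces itself:
summing √(j+1)/(j+1) costs only a factor 2 per argument. -/
lemma abs_multipleHarmonic_le_sqrt {l : List MZVArg} (hl : ∀ a ∈ l, 1 ≤ a.exponent) (n : ℕ) :
    |multipleHarmonic l n| ≤ 2 ^ l.length * √((n : ℝ) + 1) := by
  induction l generalizing n with
  | nil =>
    simp [multipleHarmonic]
  | cons a l ih =>
    have ih' := ih fun b hb => hl b (List.mem_cons_of_mem _ hb)
    have ha := hl a List.mem_cons_self
    rw [multipleHarmonic]
    calc _ ≤ ∑ j ∈ Finset.range n, |a.factor (j + 1) * multipleHarmonic l j| :=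
          Finset.abs_sum_le_sum_abs _ _
      _ ≤ ∑ j ∈ Finset.range n, 2 ^ l.length * (1 / √((j : ℝ) + 1)) := by
          refine Finset.sum_le_sum fun j _ => ?_
          rw [abs_mul]
          calc _ ≤ 1 / ((j : ℝ) + 1) * (2 ^ l.length * √((j : ℝ) + 1)) :=
                mul_le_mul (MZVArg.abs_factor_succ_le ha j) (ih' j) (abs_nonneg _) (by positivity)
            _ = _ := by rw [one_div_mul_mul_sqrt (by positivity), mul_one_div]
      _ ≤ 2 ^ l.length * (2 * √((n : ℝ) + 1)) := by
          rw [← Finset.mul_sum]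
          gcongr
          exact (sum_range_inv_sqrt_le n).trans (by gcongr; linarith)
      _ = _ := by rw [List.length_cons]; ring

lemma abs_multipleHarmonic_le_linear {l : List MZVArg} (hl : ∀ a ∈ l, 1 ≤ a.exponent) (n : ℕ) :
    |multipleHarmonic l n| ≤ 2 ^ l.length * ((n : ℝ) + 1) := by
  refine (abs_multipleHarmonic_le_sqrt hl n).trans ?_
  gcongr
  rw [Real.sqrt_le_left (by positivity)]
  nlinarith [n.cast_nonneg (α := ℝ)]

/-- Dirichlet's test by summation by parts: the partial sums of the signs are 0 or -1. Bounded
variation replaces monotonicity, which fails when inner arguments carry bars. -/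
lemma exists_tendsto_alternating_sum {b : ℕ → ℝ} (hb : Tendsto b atTop (𝓝 0))
    (hs : Summable fun n => |b (n + 1) - b n|) :
    ∃ w, Tendsto (fun n => ∑ j ∈ Finset.range n, (-1 : ℝ) ^ (j + 1) * b j) atTop (𝓝 w) := by
  set G : ℕ → ℝ := fun n => ∑ j ∈ Finset.range n, (-1 : ℝ) ^ (j + 1)
  have hG : ∀ n, |G n| ≤ 1 := by
    intro n
    have : G n = if Even n then 0 else -1 := by
      induction n with
      | zero => simp [G]
      | succ n ih =>
        have : G (n + 1) = G n + (-1) ^ (n + 1) := Finset.sum_range_succ _ _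
        rw [this, ih]
        rcases Nat.even_or_odd n with h | h
        · have h' : ¬ Even (n + 1) := by simpa [Nat.even_add_one] using h
          simp [h, h', pow_succ]
        · have h' : ¬ Even n := by simpa using h
          simp [h', h, pow_succ]
    rw [this]
    split_ifs <;> simp
  have hsum : Summable fun i => (b (i + 1) - b i) * G (i + 1) := by
    refine Summable.of_norm_bounded hs fun i => ?_
    rw [Real.norm_eq_abs, abs_mul]
    exact mul_le_of_le_one_right (abs_nonneg _) (hG _)
  refine ⟨0 - ∑' i, (b (i + 1) - b i) * G (i + 1), ?_⟩
  have h1 : Tendsto (fun n => b (n - 1) * G n) atTop (𝓝 0) := by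
    have hb' : Tendsto (fun n => b (n - 1)) atTop (𝓝 0) := hb.comp (tendsto_sub_atTop_nat 1)
    refine squeeze_zero_norm (fun n => ?_) (by simpa using hb'.abs)
    rw [Real.norm_eq_abs, abs_mul]
    exact mul_le_of_le_one_right (abs_nonneg _) (hG _)
  have h2 := (hsum.hasSum.tendsto_sum_nat).comp (tendsto_sub_atTop_nat 1)
  refine (h1.sub h2).congr fun n => ?_
  have := Finset.sum_range_by_parts b (fun j => (-1 : ℝ) ^ (j + 1)) n
  simp only [smul_eq_mul] at this
  simp only [Function.comp, G]
  rw [← this]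
  exact Finset.sum_congr rfl fun j _ => mul_comm _ _

lemma abs_multipleHarmonic_succ_sub_le {l : List MZVArg} (hl : ∀ a ∈ l, 1 ≤ a.exponent) (n : ℕ) :
    |multipleHarmonic l (n + 1) - multipleHarmonic l n| ≤ 2 ^ l.length / √((n : ℝ) + 1) := by
  cases l with
  | nil => simp [multipleHarmonic]
  | cons a l =>
    have hl' : ∀ b ∈ l, 1 ≤ b.exponent := fun b hb => hl b (List.mem_cons_of_mem _ hb)
    have ha := hl a List.mem_cons_self
    rw [multipleHarmonic, multipleHarmonic, Finset.sum_range_succ, add_sub_cancel_left, abs_mul]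
    calc _ ≤ 1 / ((n : ℝ) + 1) * (2 ^ l.length * √((n : ℝ) + 1)) :=
          mul_le_mul (MZVArg.abs_factor_succ_le ha n) (abs_multipleHarmonic_le_sqrt hl' n)
            (abs_nonneg _) (by positivity)
      _ = 2 ^ l.length / √((n : ℝ) + 1) := by
          rw [one_div_mul_mul_sqrt (by positivity)]
      _ ≤ _ := by
          gcongr
          · norm_num
          · simp

lemma exists_hasMultipleZetaValue_bar_one_cons {l : List MZVArg} (hl : ∀ a ∈ l, 1 ≤ a.exponent) :
    ∃ w, HasMultipleZetaValue (MZVArg.bar 1 :: l) w := by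
  set b : ℕ → ℝ := fun j => multipleHarmonic l j / ((j : ℝ) + 1)
  set K : ℝ := 2 ^ l.length
  have hK : 0 < K := by positivity
  have hsq : ∀ n : ℕ, √((n : ℝ) + 1) * √((n : ℝ) + 1) = n + 1 := fun n =>
    Real.mul_self_sqrt (by positivity)
  have hb : Tendsto b atTop (𝓝 0) := by
    have h1 : Tendsto (fun n : ℕ => K / √((n : ℝ) + 1)) atTop (𝓝 0) :=
      tendsto_const_nhds.div_atTop (Real.tendsto_sqrt_atTop.comp
        (tendsto_atTop_add_const_right _ _ tendsto_natCast_atTop_atTop))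
    refine squeeze_zero_norm (fun n => ?_) h1
    rw [Real.norm_eq_abs, abs_div, abs_of_pos (by positivity : (0 : ℝ) < n + 1),
      div_le_div_iff₀ (by positivity) (by positivity)]
    calc _ ≤ K * √((n : ℝ) + 1) * √((n : ℝ) + 1) := by
          gcongr
          exact abs_multipleHarmonic_le_sqrt hl n
      _ = _ := by rw [mul_assoc, hsq]
  -- Both the increment of the harmonic number and that of 1/(n+1) contribute O(n^(-3/2)).
  have hs : Summable fun n => |b (n + 1) - b n| := by
    have h32 : Summable fun n : ℕ => 2 * K * (1 / |(n : ℝ) + 1| ^ (3 / 2 : ℝ)) :=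
      ((Real.summable_one_div_nat_add_rpow 1 (3 / 2)).2 (by norm_num)).mul_left _
    refine Summable.of_nonneg_of_le (fun n => abs_nonneg _) (fun n => ?_) h32
    have hpos : (0 : ℝ) < n + 1 := by positivity
    have hpow : |(n : ℝ) + 1| ^ (3 / 2 : ℝ) = ((n : ℝ) + 1) * √((n : ℝ) + 1) := by
      rw [abs_of_pos hpos, Real.sqrt_eq_rpow, show (3 / 2 : ℝ) = 1 + 1 / 2 by norm_num,
        Real.rpow_add hpos, Real.rpow_one]
    have h0 : 0 < √((n : ℝ) + 1) := by positivity
    have hsplit : b (n + 1) - b n =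
        (multipleHarmonic l (n + 1) - multipleHarmonic l n) / ((n : ℝ) + 2) -
          multipleHarmonic l n / (((n : ℝ) + 1) * ((n : ℝ) + 2)) := by
      simp only [b]
      push_cast
      field_simp
      ring
    have e1 : |(multipleHarmonic l (n + 1) - multipleHarmonic l n) / ((n : ℝ) + 2)| ≤
        K / √((n : ℝ) + 1) / ((n : ℝ) + 1) := by
      rw [abs_div, abs_of_pos (by positivity : (0 : ℝ) < n + 2)]
      exact div_le_div₀ (by positivity) (abs_multipleHarmonic_succ_sub_le hl n) hpos (by linarith)
    have e2 : |multipleHarmonic l n / (((n : ℝ) + 1) * ((n : ℝ) + 2))| ≤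
        K * √((n : ℝ) + 1) / (((n : ℝ) + 1) * ((n : ℝ) + 1)) := by
      rw [abs_div, abs_of_pos (by positivity : (0 : ℝ) < (n + 1) * (n + 2))]
      refine div_le_div₀ (by positivity) (abs_multipleHarmonic_le_sqrt hl n) (by positivity) ?_
      gcongr
      norm_num
    have e3 : K * √((n : ℝ) + 1) / (((n : ℝ) + 1) * ((n : ℝ) + 1)) =
        K / √((n : ℝ) + 1) / ((n : ℝ) + 1) := by
      have h := hsq n
      rw [div_div, div_eq_div_iff (by positivity) (by positivity)]
      linear_combination (K * ((n : ℝ) + 1)) * h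
    have e4 : 2 * K * (1 / |(n : ℝ) + 1| ^ (3 / 2 : ℝ)) =
        2 * (K / √((n : ℝ) + 1) / ((n : ℝ) + 1)) := by
      rw [hpow]
      field_simp
    rw [hsplit, e4]
    rw [← Real.norm_eq_abs] at e1 e2 ⊢
    refine (norm_sub_le _ _).trans ?_
    linarith
  obtain ⟨w, hw⟩ := exists_tendsto_alternating_sum hb hs
  refine ⟨w, hw.congr fun n => ?_⟩
  rw [multipleHarmonic]
  refine Finset.sum_congr rfl fun j _ => ?_
  simp only [b, MZVArg.factor, MZVArg.bar, if_true]
  push_cast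
  ring

/-! ### Multiple polylogarithms in one variable -/

/-- The multiple polylogarithm with arguments `l`, as a power series in one variable. -/
noncomputable def multiplePolylog : List MZVArg → ℝ → ℝ
  | [], _ => 1
  | a :: l, x => ∑' j : ℕ, a.factor (j + 1) * multipleHarmonic l j * x ^ (j + 1)

lemma summable_multipleHarmonic_mul_pow {l : List MZVArg} (hl : ∀ a ∈ l, 1 ≤ a.exponent) {x : ℝ}
    (hx : |x| < 1) : Summable fun n => multipleHarmonic l n * x ^ n :=
  summable_mul_pow_of_abs_le_linear (abs_multipleHarmonic_le_linear hl) hx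

/-- The coefficients of the multiple polylogarithm are the increments of the harmonic numbers, so
multiplication by 1 - x telescopes. -/
lemma tsum_multipleHarmonic_mul_pow {l : List MZVArg} (hl : ∀ a ∈ l, 1 ≤ a.exponent) {x : ℝ}
    (hx : |x| < 1) : ∑' n, multipleHarmonic l n * x ^ n = multiplePolylog l x / (1 - x) := by
  have hx1 : 1 - x ≠ 0 := by linarith [(abs_lt.1 hx).2]
  have hs := summable_multipleHarmonic_mul_pow hl hx
  rw [eq_div_iff hx1]
  cases l with
  | nil =>
    simp only [multipleHarmonic, multiplePolylog, one_mul]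
    rw [tsum_geometric_of_abs_lt_one hx, inv_mul_cancel₀ hx1]
  | cons a l =>
    have h1 := hs.tsum_eq_zero_add
    have h2 : multipleHarmonic (a :: l) 0 = 0 := by simp [multipleHarmonic]
    rw [h2, zero_mul, zero_add] at h1
    have hs1 := (summable_nat_add_iff 1).2 hs
    have h3 : multiplePolylog (a :: l) x = ∑' n, multipleHarmonic (a :: l) (n + 1) * x ^ (n + 1) -
        ∑' n, x * (multipleHarmonic (a :: l) n * x ^ n) := by
      rw [multiplePolylog, ← hs1.tsum_sub (hs.mul_left x)]
      refine tsum_congr fun n => ?_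
      have : multipleHarmonic (a :: l) (n + 1) =
          multipleHarmonic (a :: l) n + a.factor (n + 1) * multipleHarmonic l n :=
        Finset.sum_range_succ _ _
      rw [this]
      ring
    rw [h3, ← h1, tsum_mul_left]
    ring

lemma multiplePolylog_bar_one_cons (l : List MZVArg) (x : ℝ) :
    multiplePolylog (MZVArg.bar 1 :: l) x = multiplePolylog (MZVArg.plain 1 :: l) (-x) := by
  refine tsum_congr fun j => ?_
  simp only [MZVArg.factor, MZVArg.bar, MZVArg.plain, if_true, Bool.false_eq_true, if_false]
  rw [neg_pow x]
  ring

lemma hasDerivAt_multiplePolylog_one_cons {l : List MZVArg} (hl : ∀ a ∈ l, 1 ≤ a.exponent) {x : ℝ}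
    (hx : |x| < 1) : HasDerivAt (multiplePolylog (MZVArg.plain 1 :: l))
      (multiplePolylog l x / (1 - x)) x := by
  rw [← tsum_multipleHarmonic_mul_pow hl hx]
  convert hasDerivAt_tsum_div_mul_pow_succ (abs_multipleHarmonic_le_linear hl) hx using 1
  funext y
  refine tsum_congr fun j => ?_
  simp only [MZVArg.factor, MZVArg.plain, Bool.false_eq_true, if_false]
  push_cast
  ring

lemma hasDerivAt_multiplePolylog_two_cons {l : List MZVArg} (hl : ∀ a ∈ l, 1 ≤ a.exponent) {x : ℝ}
    (hx : |x| < 1) (hx0 : x ≠ 0) : HasDerivAt (multiplePolylog (MZVArg.plain 2 :: l))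
      (multiplePolylog (MZVArg.plain 1 :: l) x / x) x := by
  have hc : ∀ n : ℕ, |multipleHarmonic l n / ((n : ℝ) + 1)| ≤ 2 ^ l.length * ((n : ℝ) + 1) := by
    intro n
    have hn : (1 : ℝ) ≤ n + 1 := by linarith [n.cast_nonneg (α := ℝ)]
    rw [abs_div, abs_of_pos (by positivity : (0 : ℝ) < n + 1)]
    exact (div_le_self (abs_nonneg _) hn).trans (abs_multipleHarmonic_le_linear hl n)
  have h := hasDerivAt_tsum_div_mul_pow_succ hc hx
  refine (h.congr_deriv ?_).congr_of_eventuallyEq (.of_forall fun y => ?_)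
  · rw [eq_div_iff hx0, ← tsum_mul_right]
    refine tsum_congr fun j => ?_
    simp only [MZVArg.factor, MZVArg.plain, Bool.false_eq_true, if_false]
    push_cast
    ring
  · refine tsum_congr fun j => ?_
    simp only [MZVArg.factor, MZVArg.plain, Bool.false_eq_true, if_false]
    push_cast
    have : (j : ℝ) + 1 ≠ 0 := by positivity
    field_simp

lemma tendsto_multiplePolylog_zero {a : MZVArg} {l : List MZVArg}
    (hl : ∀ b ∈ a :: l, 1 ≤ b.exponent) :
    Tendsto (multiplePolylog (a :: l)) (𝓝[<] 0) (𝓝 0) := by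
  -- The extra n + 1 presents the series as a termwise primitive, whose differentiability at 0 gives
  -- continuity there.
  have hc : ∀ n : ℕ, |((n : ℝ) + 1) * (a.factor (n + 1) * multipleHarmonic l n)| ≤
      2 ^ l.length * ((n : ℝ) + 1) := by
    intro n
    have hn : (0 : ℝ) < n + 1 := by positivity
    have h1 := MZVArg.abs_factor_succ_le (hl a List.mem_cons_self) n
    have h2 := abs_multipleHarmonic_le_linear
      (fun b hb => hl b (List.mem_cons_of_mem a hb)) n
    rw [abs_mul, abs_mul, ← mul_assoc, abs_of_pos hn]
    have h3 : ((n : ℝ) + 1) * |a.factor (n + 1)| ≤ 1 := by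
      rwa [le_div_iff₀ hn, mul_comm] at h1
    exact (mul_le_of_le_one_left (abs_nonneg _) h3).trans h2
  have h := (hasDerivAt_tsum_div_mul_pow_succ hc (x := 0) (by simp)).continuousAt.tendsto
  have h0 : Tendsto (multiplePolylog (a :: l)) (𝓝 0) (𝓝 0) := by
    convert h using 1
    · funext y
      refine tsum_congr fun j => ?_
      have : (j : ℝ) + 1 ≠ 0 := by positivity
      field_simp
    · simp
  exact h0.mono_left nhdsWithin_le_nhds

/-- Abel's theorem for alternating multiple zeta values whose first argument is `1̄`. -/
lemma hasMultipleZetaValue_bar_one_cons {l : List MZVArg} (hl : ∀ a ∈ l, 1 ≤ a.exponent) {z : ℝ}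
    (hz : Tendsto (multiplePolylog (MZVArg.plain 1 :: l)) (𝓝[>] (-1)) (𝓝 z)) :
    HasMultipleZetaValue (MZVArg.bar 1 :: l) z := by
  obtain ⟨w, hw⟩ := exists_hasMultipleZetaValue_bar_one_cons hl
  have h1 := Real.tendsto_tsum_powerSeries_nhdsWithin_lt hw
  -- Abel's theorem yields powers x^j where the polylogarithm has x^(j+1); the missing factor x
  -- tends to 1.
  have h2 : Tendsto (fun x : ℝ => x) (𝓝[<] 1) (𝓝 1) := tendsto_id.mono_left nhdsWithin_le_nhds
  have h3 := h2.mul h1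
  have h4 : Tendsto (fun x : ℝ => -x) (𝓝[<] 1) (𝓝[>] (-1)) :=
    tendsto_neg_nhdsLT
  have h5 : w = z := by
    rw [one_mul] at h3
    refine tendsto_nhds_unique (h3.congr fun x => ?_) (hz.comp h4)
    rw [Function.comp, ← multiplePolylog_bar_one_cons, multiplePolylog, ← tsum_mul_left]
    exact tsum_congr fun j => by ring
  exact h5 ▸ hw

/-! ### Polylogarithms -/

lemma hasDerivAt_polylogarithm_succ (p : ℕ) {x : ℝ} (hx : |x| < 1) (hx0 : x ≠ 0) :
    HasDerivAt (polylogarithm (p + 1)) (polylogarithm p x / x) x := by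
  have hc : ∀ n : ℕ, |1 / ((n : ℝ) + 1) ^ p| ≤ 1 * ((n : ℝ) + 1) := by
    intro n
    have hn : (1 : ℝ) ≤ n + 1 := by linarith [n.cast_nonneg (α := ℝ)]
    rw [abs_of_pos (by positivity), one_mul]
    exact (div_le_one_of_le₀ (one_le_pow₀ hn) (by positivity)).trans hn
  refine ((hasDerivAt_tsum_div_mul_pow_succ hc hx).congr_deriv ?_).congr_of_eventuallyEq
    (.of_forall fun y => ?_)
  · rw [polylogarithm, eq_div_iff hx0, ← tsum_mul_right]
    exact tsum_congr fun j => by ring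
  · exact tsum_congr fun j => by rw [div_div, ← pow_succ, one_div_mul_eq_div]

lemma polylogarithm_zero {x : ℝ} (hx : |x| < 1) : polylogarithm 0 x = x / (1 - x) := by
  simp only [polylogarithm, pow_zero, div_one, pow_succ]
  rw [tsum_mul_right, tsum_geometric_of_abs_lt_one hx]
  ring

lemma polylogarithm_one {x : ℝ} (hx : |x| < 1) : polylogarithm 1 x = -Real.log (1 - x) := by
  rw [← (Real.hasSum_pow_div_log_of_abs_lt_one hx).tsum_eq]
  simp [polylogarithm]

lemma riemannZeta_eq_polylogarithm_one {p : ℕ} (hp : 2 ≤ p) :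
    ((polylogarithm p 1 : ℝ) : ℂ) = riemannZeta p := by
  rw [zeta_nat_eq_tsum_of_gt_one (by omega)]
  have hs : Summable fun n : ℕ => 1 / (n : ℝ) ^ p := Real.summable_one_div_nat_pow.2 (by omega)
  have h : polylogarithm p 1 = ∑' n : ℕ, 1 / (n : ℝ) ^ p := by
    rw [hs.tsum_eq_zero_add, polylogarithm]
    simp [show p ≠ 0 by omega]
  rw [h]
  push_cast
  rfl

lemma tendsto_polylogarithm_one {p : ℕ} (hp : 2 ≤ p) :
    Tendsto (polylogarithm p) (𝓝[<] 1) (𝓝 (polylogarithm p 1)) := by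
  have hs : Summable fun n : ℕ => 1 / ((n : ℝ) + 1) ^ p := by
    have := (summable_nat_add_iff 1).2 (Real.summable_one_div_nat_pow.2 (by omega : 1 < p))
    simpa using this
  have hc : ContinuousOn (polylogarithm p) (Set.Icc 0 1) := by
    refine continuousOn_tsum (fun n => by fun_prop) hs fun n x hx => ?_
    rw [Real.norm_eq_abs, abs_div, abs_pow, abs_of_nonneg hx.1,
      abs_of_pos (by positivity : (0 : ℝ) < (n + 1) ^ p)]
    gcongr
    exact pow_le_one₀ hx.1 hx.2
  have h1 := hc 1 (by simp)
  have h2 : Set.Ioo (0 : ℝ) 1 ∈ 𝓝[<] (1 : ℝ) := Ioo_mem_nhdsLT (by norm_num)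
  exact h1.tendsto.mono_left (le_inf inf_le_left
    (le_principal_iff.2 (mem_of_superset h2 Set.Ioo_subset_Icc_self)))

/-! ### Combinations of logarithms and polylogarithms -/

/-- The sum `∑_{j ≤ k} (-1) ^ (k - j) (L ^ j / j!) c (q + k - j)`. -/
noncomputable def logSum (c : ℕ → ℝ) (L : ℝ) : ℕ → ℕ → ℝ
  | 0, q => c q
  | k + 1, q => L ^ (k + 1) / (k + 1).factorial * c q - logSum c L k (q + 1)

lemma hasDerivAt_pow_div_factorial (k : ℕ) (L : ℝ) :
    HasDerivAt (fun L : ℝ => L ^ (k + 1) / (k + 1).factorial) (L ^ k / k.factorial) L := by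
  refine ((hasDerivAt_pow (k + 1) L).div_const _).congr_deriv ?_
  rw [Nat.factorial_succ]
  have : (k.factorial : ℝ) ≠ 0 := by positivity
  push_cast
  field_simp

/-- With constant coefficients, raising k is one integration in L, which is exactly the effect of
one more leading 1. -/
lemma hasDerivAt_logSum (c : ℕ → ℝ) (k q : ℕ) (L : ℝ) :
    HasDerivAt (fun L => logSum c L (k + 1) q) (logSum c L k q) L := by
  induction k generalizing q with
  | zero =>
    have h := ((hasDerivAt_pow_div_factorial 0 L).mul_const (c q)).sub_const (c (q + 1))
    refine h.congr_deriv ?_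
    simp [logSum]
  | succ k ih =>
    exact ((hasDerivAt_pow_div_factorial (k + 1) L).mul_const (c q)).sub (ih (q + 1))

lemma logSum_zero (c : ℕ → ℝ) (k q : ℕ) : logSum c 0 k q = (-1) ^ k * c (q + k) := by
  induction k generalizing q with
  | zero => simp [logSum]
  | succ k ih =>
    rw [logSum, ih]
    have : q + 1 + k = q + (k + 1) := by ring
    simp [this, pow_succ]

/-- Repeated integration by parts: since u · d/du lowers the order of Li by one, the alternating
signs cancel all terms but one. -/
lemma hasDerivAt_logSum_polylogarithm (k q : ℕ) {u : ℝ} (hu : u ∈ Set.Ioo (0 : ℝ) 1) :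
    HasDerivAt (fun u => logSum (fun p => polylogarithm p u) (Real.log u) k (q + 1))
      (Real.log u ^ k / k.factorial * polylogarithm q u / u) u := by
  have hu1 : |u| < 1 := abs_lt.2 ⟨by linarith [hu.1], hu.2⟩
  induction k generalizing q with
  | zero =>
    refine (hasDerivAt_polylogarithm_succ q hu1 hu.1.ne').congr_deriv ?_
    simp
  | succ k ih =>
    have h1 := (hasDerivAt_pow_div_factorial k (Real.log u)).comp u (Real.hasDerivAt_log hu.1.ne')
    have h2 := (h1.mul (hasDerivAt_polylogarithm_succ q hu1 hu.1.ne')).sub (ih (q + 1))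
    refine h2.congr_deriv ?_
    simp only [Function.comp]
    ring

/-- Li_1(u) = -log(1-u) diverges only logarithmically, while |log u| ≤ 1/u - 1 ≤ 2(1-u) for u > 1/2.
-/
lemma tendsto_log_pow_mul_polylogarithm_one (k : ℕ) :
    Tendsto (fun u => Real.log u ^ (k + 1) * polylogarithm 1 u) (𝓝[<] 1) (𝓝 0) := by
  have hmem : Set.Ioo (1 / 2 : ℝ) 1 ∈ 𝓝[<] (1 : ℝ) := Ioo_mem_nhdsLT (by norm_num)
  have hlog : Tendsto Real.log (𝓝[<] 1) (𝓝 0) := by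
    have := (Real.continuousAt_log one_ne_zero).tendsto
    rw [Real.log_one] at this
    exact this.mono_left nhdsWithin_le_nhds
  have h1 : Tendsto (fun u : ℝ => (1 - u) * Real.log (1 - u)) (𝓝[<] 1) (𝓝 0) := by
    have hc : Continuous fun u : ℝ => (1 - u) * Real.log (1 - u) :=
      Real.continuous_mul_log.comp (continuous_const.sub continuous_id)
    have := hc.tendsto 1
    simp only [sub_self, zero_mul] at this
    exact this.mono_left nhdsWithin_le_nhds
  have h2 : Tendsto (fun u => Real.log u * polylogarithm 1 u) (𝓝[<] 1) (𝓝 0) := by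
    refine squeeze_zero_norm' ?_ (by simpa using (h1.abs.const_mul 2))
    filter_upwards [hmem] with u hu
    have hu0 : 0 < u := by linarith [hu.1]
    rw [polylogarithm_one (abs_lt.2 ⟨by linarith, hu.2⟩), Real.norm_eq_abs, abs_mul, abs_neg]
    rw [← mul_assoc]
    refine mul_le_mul_of_nonneg_right ?_ (abs_nonneg _)
    have h3 := Real.one_sub_inv_le_log_of_pos hu0
    have h4 : Real.log u ≤ 0 := Real.log_nonpos hu0.le hu.2.le
    rw [abs_of_nonpos h4, abs_of_pos (by linarith [hu.2])]
    have h5 : u⁻¹ - 1 ≤ 2 * (1 - u) := by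
      rw [inv_eq_one_div, sub_le_iff_le_add, div_le_iff₀ hu0]
      nlinarith [hu.1, hu.2]
    linarith
  have h3 := (hlog.pow k).mul h2
  rw [mul_zero] at h3
  exact h3.congr fun u => by ring

lemma tendsto_logSum_polylogarithm (k q : ℕ) (h : 2 ≤ q + k) (hq : 1 ≤ q) :
    Tendsto (fun u => logSum (fun p => polylogarithm p u) (Real.log u) k q) (𝓝[<] 1)
      (𝓝 ((-1) ^ k * polylogarithm (q + k) 1)) := by
  induction k generalizing q with
  | zero => simpa [logSum] using tendsto_polylogarithm_one h
  | succ k ih =>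
    have h1 := ih (q + 1) (by omega) (by omega)
    have h2 : Tendsto (fun u => Real.log u ^ (k + 1) / (k + 1).factorial * polylogarithm q u)
        (𝓝[<] 1) (𝓝 0) := by
      have h3 : Tendsto (fun u => Real.log u ^ (k + 1) * polylogarithm q u) (𝓝[<] 1) (𝓝 0) := by
        rcases hq.eq_or_lt with rfl | hq'
        · exact tendsto_log_pow_mul_polylogarithm_one k
        · have hlog := (Real.continuousAt_log one_ne_zero).tendsto
          rw [Real.log_one] at hlog
          have := ((hlog.mono_left nhdsWithin_le_nhds).pow (k + 1)).mul
            (tendsto_polylogarithm_one hq')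
          simpa using this
      have := h3.div_const ((k + 1).factorial : ℝ)
      rw [zero_div] at this
      exact this.congr fun u => by ring
    have h4 := h2.sub h1
    rw [show q + (k + 1) = q + 1 + k by ring, pow_succ]
    refine (h4.congr fun u => rfl).trans (le_of_eq ?_)
    congr 1
    ring

/-! ### Evaluation of multiple polylogarithms on `(-1, 0)` -/

lemma abs_lt_one_of_mem_Ioo {y : ℝ} (hy : y ∈ Set.Ioo (-1 : ℝ) 0) : |y| < 1 :=
  abs_lt.2 ⟨hy.1, hy.2.trans one_pos⟩

lemma hasDerivAt_neg_log_one_sub {y : ℝ} (hy : y < 1) :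
    HasDerivAt (fun y => -Real.log (1 - y)) (1 / (1 - y)) y := by
  have h1 : (1 : ℝ) - y ≠ 0 := by linarith
  refine (((hasDerivAt_id y).const_sub 1).log h1).neg.congr_deriv ?_
  simp [neg_div]

lemma tendsto_neg_log_one_sub_zero :
    Tendsto (fun y => -Real.log (1 - y)) (𝓝[<] 0) (𝓝 0) := by
  have h := (hasDerivAt_neg_log_one_sub one_pos).continuousAt.tendsto
  simp only [sub_zero, Real.log_one, neg_zero] at h
  exact h.mono_left nhdsWithin_le_nhds

lemma tendsto_neg_log_one_sub_neg_one :
    Tendsto (fun y => -Real.log (1 - y)) (𝓝[>] (-1)) (𝓝 (-Real.log 2)) := by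
  have h := (hasDerivAt_neg_log_one_sub (by norm_num : (-1 : ℝ) < 1)).continuousAt.tendsto
  rw [sub_neg_eq_add, one_add_one_eq_two] at h
  exact h.mono_left nhdsWithin_le_nhds

lemma one_le_exponent_replicate (k : ℕ) :
    ∀ a ∈ List.replicate k (MZVArg.plain 1), 1 ≤ a.exponent := by
  intro a ha
  rw [List.eq_of_mem_replicate ha]
  exact le_rfl

lemma one_le_exponent_replicate_append (m : ℕ) {a : MZVArg} {l : List MZVArg}
    (ha : 1 ≤ a.exponent) (hl : ∀ b ∈ l, 1 ≤ b.exponent) :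
    ∀ b ∈ List.replicate m (MZVArg.plain 1) ++ a :: l, 1 ≤ b.exponent := by
  intro b hb
  rcases List.mem_append.1 hb with hb | hb
  · exact one_le_exponent_replicate m b hb
  · rcases List.mem_cons.1 hb with rfl | hb
    · exact ha
    · exact hl b hb

lemma multiplePolylog_replicate_one (k : ℕ) : ∀ y ∈ Set.Ioo (-1 : ℝ) 0,
    multiplePolylog (List.replicate k (MZVArg.plain 1)) y =
      (-Real.log (1 - y)) ^ k / k.factorial := by
  induction k with
  | zero => simp [multiplePolylog]
  | succ k ih =>
    have hl := one_le_exponent_replicate k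
    refine eqOn_of_hasDerivAt_of_tendsto (fun y hy =>
      hasDerivAt_multiplePolylog_one_cons hl (abs_lt_one_of_mem_Ioo hy)) (fun y hy => ?_)
      (tendsto_multiplePolylog_zero (one_le_exponent_replicate (k + 1))) ?_
    · rw [ih y hy]
      refine ((hasDerivAt_pow_div_factorial k (-Real.log (1 - y))).comp y
        (hasDerivAt_neg_log_one_sub (hy.2.trans one_pos))).congr_deriv ?_
      ring
    · have := (tendsto_neg_log_one_sub_zero.pow (k + 1)).div_const ((k + 1).factorial : ℝ)
      simpa using this

/-- The list of arguments `({1}_m, 2, {1}_k)`. -/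
def onesTwoOnes (m k : ℕ) : List MZVArg :=
  List.replicate m (MZVArg.plain 1) ++ MZVArg.plain 2 :: List.replicate k (MZVArg.plain 1)

/-- The list of arguments `({1}_m, 1̄)`. -/
def onesBar (m : ℕ) : List MZVArg :=
  List.replicate m (MZVArg.plain 1) ++ [MZVArg.bar 1]

lemma one_le_exponent_onesTwoOnes (m k : ℕ) : ∀ a ∈ onesTwoOnes m k, 1 ≤ a.exponent :=
  one_le_exponent_replicate_append m (by simp [MZVArg.plain]) (one_le_exponent_replicate k)

lemma one_le_exponent_onesBar (m : ℕ) : ∀ a ∈ onesBar m, 1 ≤ a.exponent :=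
  one_le_exponent_replicate_append m (by simp [MZVArg.bar]) (by simp)

lemma tendsto_multiplePolylog_onesTwoOnes_zero (m k : ℕ) :
    Tendsto (multiplePolylog (onesTwoOnes m k)) (𝓝[<] 0) (𝓝 0) := by
  have h := one_le_exponent_onesTwoOnes m k
  cases m <;> exact tendsto_multiplePolylog_zero h

lemma tendsto_multiplePolylog_onesBar_zero (m : ℕ) :
    Tendsto (multiplePolylog (onesBar m)) (𝓝[<] 0) (𝓝 0) := by
  have h := one_le_exponent_onesBar m
  cases m <;> exact tendsto_multiplePolylog_zero h

lemma hasDerivAt_multiplePolylog_onesTwoOnes_succ (m k : ℕ) {y : ℝ}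
    (hy : y ∈ Set.Ioo (-1 : ℝ) 0) : HasDerivAt (multiplePolylog (onesTwoOnes (m + 1) k))
      (multiplePolylog (onesTwoOnes m k) y / (1 - y)) y :=
  hasDerivAt_multiplePolylog_one_cons (one_le_exponent_onesTwoOnes m k) (abs_lt_one_of_mem_Ioo hy)

lemma hasDerivAt_multiplePolylog_onesTwoOnes_zero (k : ℕ) {y : ℝ}
    (hy : y ∈ Set.Ioo (-1 : ℝ) 0) : HasDerivAt (multiplePolylog (onesTwoOnes 0 k))
      ((-Real.log (1 - y)) ^ (k + 1) / (k + 1).factorial / y) y := by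
  rw [← multiplePolylog_replicate_one (k + 1) y hy]
  exact hasDerivAt_multiplePolylog_two_cons (one_le_exponent_replicate k)
    (abs_lt_one_of_mem_Ioo hy) hy.2.ne

/-- Integration by parts moves the leading ones behind the two. -/
lemma multiplePolylog_onesTwoOnes_succ (m k : ℕ) : ∀ y ∈ Set.Ioo (-1 : ℝ) 0,
    ((m : ℝ) + 1) * multiplePolylog (onesTwoOnes (m + 1) k) y =
      -Real.log (1 - y) * multiplePolylog (onesTwoOnes m k) y -
        ((k : ℝ) + 2) * multiplePolylog (onesTwoOnes m (k + 1)) y := by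
  have hleft : ∀ m k : ℕ, Tendsto (fun y => ((m : ℝ) + 1) *
      multiplePolylog (onesTwoOnes (m + 1) k) y) (𝓝[<] 0) (𝓝 0) := by
    intro m k
    simpa using (tendsto_multiplePolylog_onesTwoOnes_zero (m + 1) k).const_mul ((m : ℝ) + 1)
  have hright : ∀ m k : ℕ, Tendsto (fun y => -Real.log (1 - y) *
      multiplePolylog (onesTwoOnes m k) y - ((k : ℝ) + 2) *
        multiplePolylog (onesTwoOnes m (k + 1)) y) (𝓝[<] 0) (𝓝 0) := by
    intro m k
    have h1 := tendsto_neg_log_one_sub_zero.mul (tendsto_multiplePolylog_onesTwoOnes_zero m k)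
    have h2 := (tendsto_multiplePolylog_onesTwoOnes_zero m (k + 1)).const_mul ((k : ℝ) + 2)
    simpa using h1.sub h2
  induction m generalizing k with
  | zero =>
    refine eqOn_of_hasDerivAt_of_tendsto (fun y hy =>
      (hasDerivAt_multiplePolylog_onesTwoOnes_succ 0 k hy).const_mul _) (fun y hy => ?_)
      (hleft 0 k) (hright 0 k)
    -- The two terms with denominator y cancel because (k+2)/(k+2)! = 1/(k+1)!.
    refine (((hasDerivAt_neg_log_one_sub (hy.2.trans one_pos)).mul
      (hasDerivAt_multiplePolylog_onesTwoOnes_zero k hy)).sub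
      ((hasDerivAt_multiplePolylog_onesTwoOnes_zero (k + 1) hy).const_mul
        ((k : ℝ) + 2))).congr_deriv ?_
    have h1 : y ≠ 0 := hy.2.ne
    have h2 : 1 - y ≠ 0 := by linarith [hy.2]
    have h3 : ((k + 1).factorial : ℝ) ≠ 0 := by positivity
    have h4 : (k : ℝ) + 2 ≠ 0 := by positivity
    rw [Nat.factorial_succ (k + 1)]
    push_cast
    rw [show (k : ℝ) + 1 + 1 = k + 2 by ring]
    field_simp
    ring
  | succ m ih =>
    refine eqOn_of_hasDerivAt_of_tendsto (fun y hy =>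
      (hasDerivAt_multiplePolylog_onesTwoOnes_succ (m + 1) k hy).const_mul _) (fun y hy => ?_)
      (hleft (m + 1) k) (hright (m + 1) k)
    refine (((hasDerivAt_neg_log_one_sub (hy.2.trans one_pos)).mul
      (hasDerivAt_multiplePolylog_onesTwoOnes_succ m k hy)).sub
      ((hasDerivAt_multiplePolylog_onesTwoOnes_succ m (k + 1) hy).const_mul
        ((k : ℝ) + 2))).congr_deriv ?_
    push_cast
    -- The product rule gives one copy of the function with m + 1 leading ones; the induction
    -- hypothesis turns the rest into m + 1 more.
    linear_combination (-1 / (1 - y)) * ih k y hy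

/-- A primitive of `-log u ^ (k + 1) / ((k + 1)! u (1 - u))`. -/
noncomputable def logPrimitive (k : ℕ) (u : ℝ) : ℝ :=
  -(Real.log u ^ (k + 2) / (k + 2).factorial) -
    logSum (fun p => polylogarithm p u) (Real.log u) (k + 1) 1

/-- Partial fractions: 1/(u(1-u)) = 1/u + Li_0(u)/u. -/
lemma hasDerivAt_logPrimitive (k : ℕ) {u : ℝ} (hu : u ∈ Set.Ioo (0 : ℝ) 1) :
    HasDerivAt (logPrimitive k)
      (-(Real.log u ^ (k + 1) / (k + 1).factorial / (u * (1 - u)))) u := by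
  have h := ((hasDerivAt_pow_div_factorial (k + 1) (Real.log u)).comp u
    (Real.hasDerivAt_log hu.1.ne')).neg.sub (hasDerivAt_logSum_polylogarithm (k + 1) 0 hu)
  refine h.congr_deriv ?_
  rw [polylogarithm_zero (abs_lt.2 ⟨by linarith [hu.1], hu.2⟩)]
  have h1 : u ≠ 0 := hu.1.ne'
  have h2 : 1 - u ≠ 0 := by linarith [hu.2]
  field_simp
  ring

lemma tendsto_logPrimitive_one (k : ℕ) :
    Tendsto (logPrimitive k) (𝓝[<] 1) (𝓝 ((-1) ^ k * polylogarithm (k + 2) 1)) := by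
  have hlog := (Real.continuousAt_log one_ne_zero).tendsto
  rw [Real.log_one] at hlog
  replace hlog : Tendsto Real.log (𝓝[<] 1) (𝓝 0) := hlog.mono_left nhdsWithin_le_nhds
  have h1 := (hlog.pow (k + 2)).div_const ((k + 2).factorial : ℝ)
  have h2 := h1.neg.sub (tendsto_logSum_polylogarithm (k + 1) 1 (by omega) le_rfl)
  refine (h2.congr fun u => rfl).trans (le_of_eq ?_)
  rw [show 1 + (k + 1) = k + 2 by ring]
  simp [pow_succ]

/-- Under u = 1/(1-y), L becomes log u and dy/y becomes -du/(u(1-u)). The subtracted constant is the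
limit of the primitive at u = 1, that is, at y = 0. -/
lemma multiplePolylog_onesTwoOnes_zero (k : ℕ) : ∀ y ∈ Set.Ioo (-1 : ℝ) 0,
    multiplePolylog (onesTwoOnes 0 k) y =
      logPrimitive k (1 - y)⁻¹ - (-1) ^ k * polylogarithm (k + 2) 1 := by
  refine eqOn_of_hasDerivAt_of_tendsto
    (fun y hy => hasDerivAt_multiplePolylog_onesTwoOnes_zero k hy) (fun y hy => ?_)
    (tendsto_multiplePolylog_onesTwoOnes_zero 0 k) ?_
  · have h0 : 1 < 1 - y := by linarith [hy.2]
    have hu : (1 - y)⁻¹ ∈ Set.Ioo (0 : ℝ) 1 := ⟨by positivity, inv_lt_one_of_one_lt₀ h0⟩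
    have h1 : 1 - y ≠ 0 := by positivity
    have h2 := (((hasDerivAt_id y).const_sub 1).inv h1)
    refine (((hasDerivAt_logPrimitive k hu).comp y h2).sub_const _).congr_deriv ?_
    have h3 : y ≠ 0 := hy.2.ne
    have h4 : 1 - (1 - y)⁻¹ = -y / (1 - y) := by
      field_simp
      ring
    rw [Real.log_inv, h4]
    simp only [id]
    field_simp
  · have h1 : Tendsto (fun y : ℝ => (1 - y)⁻¹) (𝓝[<] 0) (𝓝[<] 1) := by
      refine tendsto_nhdsWithin_iff.2 ⟨?_, ?_⟩
      · have : ContinuousAt (fun y : ℝ => (1 - y)⁻¹) 0 :=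
          ContinuousAt.inv₀ (by fun_prop) (by norm_num)
        have h := this.tendsto
        simp only [sub_zero, inv_one] at h
        exact h.mono_left nhdsWithin_le_nhds
      · filter_upwards [self_mem_nhdsWithin] with y hy
        have hy0 : y < 0 := hy
        exact Set.mem_Iio.2 (inv_lt_one_of_one_lt₀ (by linarith))
    have h2 := ((tendsto_logPrimitive_one k).comp h1).sub_const
      ((-1) ^ k * polylogarithm (k + 2) 1)
    rwa [sub_self] at h2

/-- In the variable L, differentiating Li_{m+1}((1-y)/2) gives -Li_m((1-y)/2), whence the sign
(-1)^m; the `logSum` term normalises the value at y = 0. The start m = 0 is Li_1(-y) = -log(1+y). -/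
lemma multiplePolylog_onesBar (m : ℕ) : ∀ y ∈ Set.Ioo (-1 : ℝ) 0,
    multiplePolylog (onesBar m) y = (-1) ^ m * polylogarithm (m + 1) ((1 - y) / 2) -
      logSum (fun p => polylogarithm p (1 / 2)) (-Real.log (1 - y)) m 1 := by
  have hpoly : ∀ m : ℕ, ∀ y ∈ Set.Ioo (-1 : ℝ) 0, HasDerivAt
      (fun y => (-1 : ℝ) ^ m * polylogarithm (m + 1) ((1 - y) / 2))
      (-((-1) ^ m * polylogarithm m ((1 - y) / 2)) / (1 - y)) y := by
    intro m y hy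
    have h1 : |(1 - y) / 2| < 1 := abs_lt.2 ⟨by linarith [hy.2], by linarith [hy.1]⟩
    have h2 : 1 - y ≠ 0 := by linarith [hy.2]
    refine (((hasDerivAt_polylogarithm_succ m h1 (by positivity)).comp y
      (((hasDerivAt_id y).const_sub 1).div_const 2)).const_mul ((-1 : ℝ) ^ m)).congr_deriv ?_
    field_simp
  have hlim : ∀ m : ℕ, Tendsto (fun y => (-1) ^ m * polylogarithm (m + 1) ((1 - y) / 2) -
      logSum (fun p => polylogarithm p (1 / 2)) (-Real.log (1 - y)) m 1) (𝓝[<] 0) (𝓝 0) := by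
    intro m
    have h1 : ContinuousAt (polylogarithm (m + 1)) ((1 - 0) / 2) :=
      (hasDerivAt_polylogarithm_succ m (by norm_num [abs_lt]) (by norm_num)).continuousAt
    have h2 : ContinuousAt (fun y : ℝ => polylogarithm (m + 1) ((1 - y) / 2)) 0 :=
      ContinuousAt.comp (f := fun y : ℝ => (1 - y) / 2) h1 (by fun_prop)
    have h3 : ContinuousAt (fun L => logSum (fun p => polylogarithm p (1 / 2)) L m 1) 0 := by
      cases m with
      | zero => exact continuousAt_const
      | succ m => exact (hasDerivAt_logSum _ m 1 0).continuousAt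
    have h4 := ((h2.tendsto.mono_left nhdsWithin_le_nhds).const_mul ((-1 : ℝ) ^ m)).sub
      (h3.tendsto.comp tendsto_neg_log_one_sub_zero)
    rw [logSum_zero, sub_zero, add_comm 1 m, sub_self] at h4
    exact h4
  induction m with
  | zero =>
    refine eqOn_of_hasDerivAt_of_tendsto (d := fun y => -(1 / (1 + y))) (fun y hy => ?_)
      (fun y hy => ?_) (tendsto_multiplePolylog_onesBar_zero 0) (hlim 0)
    · have h1 : |-y| < 1 := by rw [abs_neg]; exact abs_lt_one_of_mem_Ioo hy
      have h2 := (hasDerivAt_multiplePolylog_one_cons (l := []) (by simp) h1).comp y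
        (hasDerivAt_neg y)
      refine (h2.congr_deriv ?_).congr_of_eventuallyEq
        (.of_forall fun y => multiplePolylog_bar_one_cons [] y)
      simp [multiplePolylog]
    · refine ((hpoly 0 y hy).sub_const _).congr_deriv ?_
      have h1 : |(1 - y) / 2| < 1 := abs_lt.2 ⟨by linarith [hy.2], by linarith [hy.1]⟩
      have h2 : 1 - y ≠ 0 := by linarith [hy.2]
      have h3 : 1 + y ≠ 0 := by linarith [hy.1]
      have h4 : 1 - (1 - y) / 2 = (1 + y) / 2 := by ring
      rw [polylogarithm_zero h1, h4]
      field_simp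
  | succ m ih =>
    refine eqOn_of_hasDerivAt_of_tendsto (fun y hy =>
      hasDerivAt_multiplePolylog_one_cons (one_le_exponent_onesBar m) (abs_lt_one_of_mem_Ioo hy))
      (fun y hy => ?_) (tendsto_multiplePolylog_onesBar_zero (m + 1)) (hlim (m + 1))
    have h1 := (hasDerivAt_logSum (fun p => polylogarithm p (1 / 2)) m 1
      (-Real.log (1 - y))).comp y (hasDerivAt_neg_log_one_sub (hy.2.trans one_pos))
    refine ((hpoly (m + 1) y hy).sub h1).congr_deriv ?_
    rw [ih y hy]
    ring

/-! ### Limits at `-1` and membership in the algebra -/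

lemma log_two_mem_zetaPolylogAlgebra : Real.log 2 ∈ zetaPolylogAlgebra :=
  Algebra.subset_adjoin (Or.inr rfl)

lemma polylogarithm_half_mem_zetaPolylogAlgebra {p : ℕ} (hp : 1 ≤ p) :
    polylogarithm p (1 / 2) ∈ zetaPolylogAlgebra :=
  Algebra.subset_adjoin (Or.inl (Or.inr ⟨p, hp, rfl⟩))

lemma polylogarithm_one_mem_zetaPolylogAlgebra {p : ℕ} (hp : 2 ≤ p) :
    polylogarithm p 1 ∈ zetaPolylogAlgebra :=
  Algebra.subset_adjoin (Or.inl (Or.inl ⟨p, hp, riemannZeta_eq_polylogarithm_one hp⟩))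

lemma div_natCast_mem_zetaPolylogAlgebra {x : ℝ} (hx : x ∈ zetaPolylogAlgebra) (n : ℕ) :
    x / n ∈ zetaPolylogAlgebra := by
  have h := zetaPolylogAlgebra.smul_mem hx (1 / n : ℚ)
  rw [Rat.smul_def] at h
  push_cast at h
  rwa [one_div_mul_eq_div] at h

lemma neg_one_pow_mul_mem_zetaPolylogAlgebra {x : ℝ} (hx : x ∈ zetaPolylogAlgebra) (n : ℕ) :
    (-1) ^ n * x ∈ zetaPolylogAlgebra :=
  mul_mem (pow_mem (neg_mem (one_mem _)) n) hx

lemma logSum_mem_zetaPolylogAlgebra {c : ℕ → ℝ} (hc : ∀ p, 1 ≤ p → c p ∈ zetaPolylogAlgebra)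
    {L : ℝ} (hL : L ∈ zetaPolylogAlgebra) (k q : ℕ) (hq : 1 ≤ q) :
    logSum c L k q ∈ zetaPolylogAlgebra := by
  induction k generalizing q with
  | zero => exact hc q hq
  | succ k ih =>
    exact sub_mem (mul_mem (div_natCast_mem_zetaPolylogAlgebra (pow_mem hL _) _) (hc q hq))
      (ih (q + 1) (by omega))

lemma Ioo_mem_nhdsGT_neg_one : Set.Ioo (-1 : ℝ) 0 ∈ 𝓝[>] (-1 : ℝ) :=
  Ioo_mem_nhdsGT (by norm_num)

lemma exists_tendsto_multiplePolylog_onesTwoOnes (m k : ℕ) : ∃ z ∈ zetaPolylogAlgebra,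
    Tendsto (multiplePolylog (onesTwoOnes m k)) (𝓝[>] (-1)) (𝓝 z) := by
  induction m generalizing k with
  | zero =>
    have hlog : Real.log (1 / 2) ∈ zetaPolylogAlgebra := by
      rw [one_div, Real.log_inv]
      exact neg_mem log_two_mem_zetaPolylogAlgebra
    refine ⟨logPrimitive k (1 / 2) - (-1) ^ k * polylogarithm (k + 2) 1, sub_mem (sub_mem
      (neg_mem (div_natCast_mem_zetaPolylogAlgebra (pow_mem hlog _) _))
      (logSum_mem_zetaPolylogAlgebra (fun p => polylogarithm_half_mem_zetaPolylogAlgebra) hlog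
        (k + 1) 1 le_rfl)) (neg_one_pow_mul_mem_zetaPolylogAlgebra
          (polylogarithm_one_mem_zetaPolylogAlgebra (by omega)) _), ?_⟩
    have h1 : ContinuousAt (logPrimitive k) (1 - -1)⁻¹ :=
      (hasDerivAt_logPrimitive k (by norm_num)).continuousAt
    have h2 : ContinuousAt (fun y : ℝ => logPrimitive k (1 - y)⁻¹) (-1) :=
      ContinuousAt.comp (f := fun y : ℝ => (1 - y)⁻¹) h1
        (ContinuousAt.inv₀ (by fun_prop) (by norm_num))
    have h3 := (h2.tendsto.mono_left (nhdsWithin_le_nhds (s := Set.Ioi (-1)))).sub_const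
      ((-1) ^ k * polylogarithm (k + 2) 1)
    rw [show (1 - -1 : ℝ)⁻¹ = 1 / 2 by norm_num] at h3
    refine h3.congr' ?_
    filter_upwards [Ioo_mem_nhdsGT_neg_one] with y hy
    exact (multiplePolylog_onesTwoOnes_zero k y hy).symm
  | succ m ih =>
    obtain ⟨z, hz, hzt⟩ := ih k
    obtain ⟨w, hw, hwt⟩ := ih (k + 1)
    have h := ((tendsto_neg_log_one_sub_neg_one.mul hzt).sub
      (hwt.const_mul ((k : ℝ) + 2))).div_const (((m + 1 : ℕ) : ℝ))
    have hk : ((k : ℝ) + 2) ∈ zetaPolylogAlgebra := by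
      exact_mod_cast natCast_mem zetaPolylogAlgebra (k + 2)
    refine ⟨_, div_natCast_mem_zetaPolylogAlgebra (sub_mem
      (mul_mem (neg_mem log_two_mem_zetaPolylogAlgebra) hz) (mul_mem hk hw)) (m + 1),
      h.congr' ?_⟩
    filter_upwards [Ioo_mem_nhdsGT_neg_one] with y hy
    rw [← multiplePolylog_onesTwoOnes_succ m k y hy]
    push_cast
    field_simp

lemma exists_tendsto_multiplePolylog_onesBar {m : ℕ} (hm : 1 ≤ m) : ∃ z ∈ zetaPolylogAlgebra,
    Tendsto (multiplePolylog (onesBar m)) (𝓝[>] (-1)) (𝓝 z) := by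
  obtain ⟨m, rfl⟩ := Nat.exists_eq_add_of_le' hm
  -- At least one leading 1 makes the order at least 2, so that the polylogarithm stays finite as
  -- (1-y)/2 → 1.
  refine ⟨(-1) ^ (m + 1) * polylogarithm (m + 2) 1 -
    logSum (fun p => polylogarithm p (1 / 2)) (-Real.log 2) (m + 1) 1,
    sub_mem (neg_one_pow_mul_mem_zetaPolylogAlgebra
      (polylogarithm_one_mem_zetaPolylogAlgebra (by omega)) _)
    (logSum_mem_zetaPolylogAlgebra (fun p => polylogarithm_half_mem_zetaPolylogAlgebra)
      (neg_mem log_two_mem_zetaPolylogAlgebra) _ _ le_rfl), ?_⟩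
  have h1 : Tendsto (fun y : ℝ => (1 - y) / 2) (𝓝[>] (-1)) (𝓝[<] 1) := by
    refine tendsto_nhdsWithin_iff.2 ⟨?_, ?_⟩
    · have h : ContinuousAt (fun y : ℝ => (1 - y) / 2) (-1) := by fun_prop
      have h := h.tendsto
      norm_num at h
      exact h.mono_left nhdsWithin_le_nhds
    · filter_upwards [self_mem_nhdsWithin] with y hy
      have : -1 < y := hy
      exact Set.mem_Iio.2 (by linarith)
  have h2 := ((tendsto_polylogarithm_one (by omega : 2 ≤ m + 2)).comp h1).const_mul
    ((-1 : ℝ) ^ (m + 1))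
  have h3 := ((hasDerivAt_logSum (fun p => polylogarithm p (1 / 2)) m 1
    (-Real.log 2)).continuousAt.tendsto.comp tendsto_neg_log_one_sub_neg_one)
  refine (h2.sub h3).congr' ?_
  filter_upwards [Ioo_mem_nhdsGT_neg_one] with y hy
  exact (multiplePolylog_onesBar (m + 1) y hy).symm

theorem theorem6p1 (m k : ℕ) (hm : 1 ≤ m) (hk : 1 ≤ k) :
    (∃ z ∈ zetaPolylogAlgebra,
      HasMultipleZetaValue
        (MZVArg.bar 1 :: (List.replicate (m - 1) (MZVArg.plain 1) ++ [MZVArg.bar 1])) z) ∧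
    (∃ z ∈ zetaPolylogAlgebra,
      HasMultipleZetaValue
        (MZVArg.bar 1 :: (List.replicate (m - 1) (MZVArg.plain 1) ++
          MZVArg.plain 2 :: List.replicate (k - 1) (MZVArg.plain 1))) z) := by
  obtain ⟨m, rfl⟩ := Nat.exists_eq_add_of_le' hm
  obtain ⟨k, rfl⟩ := Nat.exists_eq_add_of_le' hk
  constructor
  -- Losing its bar, the first argument joins the ones that follow it, so the number of leading ones
  -- rises by one.
  · obtain ⟨z, hz, hzt⟩ := exists_tendsto_multiplePolylog_onesBar hm
    exact ⟨z, hz, hasMultipleZetaValue_bar_one_cons (one_le_exponent_onesBar m) hzt⟩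
  · obtain ⟨z, hz, hzt⟩ := exists_tendsto_multiplePolylog_onesTwoOnes (m + 1) k
    exact ⟨z, hz, hasMultipleZetaValue_bar_one_cons (one_le_exponent_onesTwoOnes m k) hzt⟩
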